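/- Let $\mathcal H$ be a separable real Hilbert space with an orthogonal decomposition $\mathcal H=\mathcal H_0\oplus\mathcal H_1$, where $\dim\mathcal H_0=m<\infty$ and $\dim\mathcal H_1=\infty$, and let $\chi_1$ be the projection of $\mathcal H$ onto $\mathcal H_1$. Let $\mathcal I\subset\mathbb R^d$, let $\{L_t\}_{t\in\mathcal I}\subset\mathcal H^*$ be a family of bounded linear functionals, let $\phi_T$ be a Borel probability measure on $\mathcal I$, and let $\phi_0$ be a probability measure on $\mathbb R$ with mean $0$ and finite variance $\sigma^2$. On a probability space $(\Omega,\mathcal F,\mathbb P)$ let $(t_i)_{i\ge1}$ be i.i.d. with law $\phi_T$ and $(\epsilon_i)_{i\ge1}$ i.i.d. with law $\phi_0$, the two sequences being independent of each other. Fix $\mu^\dagger\in\mathcal H$ and put $L_i=L_{t_i}$ and $y_i=L_i\mu^\dagger+\epsilon_i$. Assume that 1. $\operatorname{supp}(\phi_T)$ has at least $m$ points, and if $L_t\mu=L_r\mu$ for all $\mu\in\mathcal H_0$, then $t=r$; 2. there is $\alpha>0$ with $\|L_t\|_{\mathcal H^*}\le\alpha$ for $\phi_T$-almost every $t\in\mathcal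 I$; 3. $\lambda_n=n^{-p}$ with $0<p\le\frac12$; 4. for $\nu\in\mathcal H$, $\int_{\mathcal I}(L_t\nu)^2\,\phi_T(\mathrm dt)=0$ if and only if $\nu=0$; 5. $t\mapsto L_t$ is continuous on $\mathcal I$, that is, $\|L_s-L_t\|_{\mathcal H^*}\to0$ as $s\to t$. Let $$f_n^{(\omega)}(\mu)=\frac1n\sum_{i=1}^n(y_i-L_i\mu)^2+\lambda_n\|\chi_1\mu\|^2,\qquad \mu\in\mathcal H.$$ Then, for almost every $\omega$, $f_n^{(\omega)}$ has a unique minimizer $\mu^n$ over $\mathcal H$ for all sufficiently large $n$ (how large may depend on $\omega$), and, whatever value in $\mathcal H$ is given to $\mu^n(\omega)$ when the minimizer of $f_n^{(\omega)}$ is not unique, $\mu^n$ converges to $\mu^\dagger$ in the following sense: for every $F\in\mathcal H^*$ and all $\epsilon,\delta>0$ there is $N=N(\epsilon,\delta,F)\in\mathbb N$ such that $$\mathbb P\bigl(|F(\mu^n)-F(\mu^\dagger)|\ge\epsilon\bigr)\le\delta\qquad\text{for all } n\ge N.$$ Here $\mathbb P$ is read as outer measure if the values chosen make the event non-measurable.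 -/

import Mathlib

open MeasureTheory ProbabilityTheory Filter Topology

noncomputable section

/-- The datum `y = L_t μ† + ε`, for the observation operator `L t` and the noise value `e`. -/
def splineDatum {H : Type*} [NormedAddCommGroup H] [InnerProductSpace ℝ H] {T : Type*}
    (L : T → StrongDual ℝ H) (μd : H) (t : T) (e : ℝ) : ℝ :=
  L t μd + e

/-- The smoothing spline functional
`ν ↦ (1/n) ∑_{i < n} (y i - L_{t i} ν)² + lam * ‖χ₁ ν‖²`, where `χ₁` is the projection of
`H = H₀ ⊕ H₁` onto `H₁` along `H₀`. The first `n` observations are those with index `i < n`. -/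
def splineFunctional {H : Type*} [NormedAddCommGroup H] [InnerProductSpace ℝ H]
    {H₀ H₁ : Submodule ℝ H} (hcompl : IsCompl H₀ H₁) {T : Type*} (L : T → StrongDual ℝ H)
    (n : ℕ) (lam : ℝ) (t : ℕ → T) (y : ℕ → ℝ) (ν : H) : ℝ :=
  (1 / (n : ℝ)) * ∑ i ∈ Finset.range n, (y i - L (t i) ν) ^ 2
    + lam * ‖H₁.projection H₀ hcompl.symm ν‖ ^ 2

/-- `ν` is a global minimizer of `f` over the whole space. -/
def IsGlobalMinimizer {H : Type*} (f : H → ℝ) (ν : H) : Prop :=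
  ∀ ν' : H, f ν ≤ f ν'

end

/-! Let `A` be the form of `S = ∫ L_s ⊗ L_s`, `A_n` its empirical version and `k = μ^n - μ†`. `A` is
positive definite but need not be coercive; `A + ‖χ·‖²` is coercive because `H₀` is finite
dimensional (`exists_coercive_add_norm_sq`). The strong law gives `A_n → A` in operator norm, so
coercivity passes to `A_n + ‖χ·‖²`, and the minimizer is eventually unique. Comparing `f_n` at `μ^n`
and `μ†` (`IsGlobalMinimizer.energy_le`) bounds `A_n(k,k) + λ‖χ k‖²` by a multiple of `(noise +
λ)‖k‖`. The averaged noise is `O(n^(-1/2))` in probability, hence `O(λ_n)` as `p ≤ 1/2`. Since the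
left side is at least a multiple of `λ‖k‖²`, `k` stays bounded; then `A_n(k,k) = O(λ_n)`, so
`A(k,k)` is small. As `S` has dense range, on bounded sets this makes every `F k` small
(`exists_forall_abs_lt_of_apply_self_le`): the convergence is weak. -/

/-! ### Quadratic functionals on a Hilbert space -/

section Deterministic

variable {H : Type*} [NormedAddCommGroup H] [InnerProductSpace ℝ H]

/-- A positive definite form together with `χ` controls the norm when `1 - χ` has values in a finite
dimensional subspace. -/
theorem exists_coercive_add_norm_sq {H₀ : Submodule ℝ H} [FiniteDimensional ℝ H₀]
    (A : H →L[ℝ] H →L[ℝ] ℝ) (hA0 : ∀ v, 0 ≤ A v v) (hA : ∀ v, A v v = 0 → v = 0)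
    (χ : H →L[ℝ] H) (hχ : ∀ v, v - χ v ∈ H₀) :
    ∃ c : ℝ, 0 < c ∧ ∀ v, c * ‖v‖ ^ 2 ≤ A v v + ‖χ v‖ ^ 2 := by
  obtain ⟨c₀, hc₀, hlow⟩ : ∃ c : ℝ, 0 < c ∧ ∀ v ∈ H₀, c * ‖v‖ ^ 2 ≤ A v v := by
    rcases (Metric.sphere (0 : H₀) 1).eq_empty_or_nonempty with he | hne
    · refine ⟨1, one_pos, fun v hv => ?_⟩
      rcases eq_or_ne v 0 with rfl | hv0
      · simp
      · exfalso
        have : (‖v‖⁻¹ • (⟨v, hv⟩ : H₀)) ∈ Metric.sphere (0 : H₀) 1 := by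
          have hn : ‖v‖ ≠ 0 := norm_ne_zero_iff.2 hv0
          simp [norm_smul, hn]
        simp [he] at this
    · have hc : Continuous fun v : H₀ => A v v := by fun_prop
      obtain ⟨w, hw, hmin⟩ := (isCompact_sphere (0 : H₀) 1).exists_isMinOn hne hc.continuousOn
      have hw1 : ‖w‖ = 1 := by simpa using hw
      refine ⟨A w w, lt_of_le_of_ne (hA0 _) fun h => ?_, fun v hv => ?_⟩
      · have : (w : H) = 0 := hA _ h.symm
        have h0 : w = 0 := by exact_mod_cast this
        simp [h0] at hw1
      · rcases eq_or_ne v 0 with rfl | hv0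
        · simp
        have hn : ‖v‖ ≠ 0 := norm_ne_zero_iff.2 hv0
        have hs : (‖v‖⁻¹ • (⟨v, hv⟩ : H₀)) ∈ Metric.sphere (0 : H₀) 1 := by
          simp [norm_smul, hn]
        have := hmin hs
        simp only [Set.mem_ofPred_eq, Submodule.coe_smul, map_smul, smul_apply,
          smul_eq_mul] at this
        calc A w w * ‖v‖ ^ 2 ≤ (‖v‖⁻¹ * (‖v‖⁻¹ * A v v)) * ‖v‖ ^ 2 := by gcongr
          _ = A v v := by field_simp
  -- The parallelogram identity gives `A(v-χv, v-χv) ≤ 2 A(v,v) + 2 A(χv,χv)`. With `h1` and `h4`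
  -- this yields `h5`, and the constant dominates both of its coefficients.
  have hM : 0 < 4 + 4 * ‖A‖ + 2 * c₀ := by positivity
  refine ⟨c₀ / (4 + 4 * ‖A‖ + 2 * c₀), by positivity, fun v => ?_⟩
  rw [div_mul_eq_mul_div, div_le_iff₀ hM]
  have h1 := hlow _ (hχ v)
  have h2 := hA0 (v + χ v)
  have h3 : A (χ v) (χ v) ≤ ‖A‖ * ‖χ v‖ * ‖χ v‖ :=
    (le_abs_self _).trans (A.le_opNorm₂ (χ v) (χ v))
  have h4 : ‖v‖ ^ 2 ≤ 2 * ‖v - χ v‖ ^ 2 + 2 * ‖χ v‖ ^ 2 := by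
    have := norm_add_le (v - χ v) (χ v)
    rw [sub_add_cancel] at this
    nlinarith [sq_nonneg (‖v - χ v‖ - ‖χ v‖), norm_nonneg v]
  simp only [map_sub, map_add, sub_apply, add_apply]
    at h1 h2
  have h5 : c₀ * ‖v‖ ^ 2 ≤ 4 * A v v + (4 * ‖A‖ + 2 * c₀) * ‖χ v‖ ^ 2 := by
    nlinarith
  have h6 := hA0 v
  have h7 : 0 ≤ (4 * ‖A‖ + 2 * c₀) * A v v := by positivity
  nlinarith [sq_nonneg ‖χ v‖]

/-- On bounded sets, smallness of a positive definite form forces smallness of functionals. -/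
theorem exists_forall_abs_lt_of_apply_self_le [CompleteSpace H]
    (A : H →L[ℝ] H →L[ℝ] ℝ) (hsymm : ∀ v w, A v w = A w v) (hA0 : ∀ v, 0 ≤ A v v)
    (hA : ∀ v, A v v = 0 → v = 0) (F : StrongDual ℝ H) (R : ℝ) {e : ℝ} (he : 0 < e) :
    ∃ η : ℝ, 0 < η ∧ ∀ h, ‖h‖ ≤ R → A h h ≤ η → |F h| < e := by
  set S := InnerProductSpace.continuousLinearMapOfBilin A with hS
  have hSin : ∀ v w, inner ℝ (S v) w = A v w := fun v w =>
    InnerProductSpace.continuousLinearMapOfBilin_apply A v w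
  -- A vector orthogonal to the range satisfies `A v v = ⟪S v, v⟫ = 0`.
  have hdense : S.range.topologicalClosure = ⊤ := by
    rw [Submodule.topologicalClosure_eq_top_iff, Submodule.eq_bot_iff]
    intro v hv
    refine hA v ?_
    rw [← hSin]
    exact (Submodule.mem_orthogonal _ _).1 hv _ ⟨v, rfl⟩
  set f := (InnerProductSpace.toDual ℝ H).symm F with hf
  have hF : ∀ h, F h = inner ℝ f h := fun h => by
    rw [hf, InnerProductSpace.toDual_symm_apply]
  have hfc : f ∈ closure (S.range : Set H) := by
    have : f ∈ S.range.topologicalClosure := by rw [hdense]; trivial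
    exact this
  obtain ⟨-, ⟨g, rfl⟩, hg⟩ := Metric.mem_closure_iff.1 hfc (e / (2 * (|R| + 1))) (by positivity)
  rw [dist_eq_norm] at hg
  -- Weighted Cauchy–Schwarz: positivity at `s g ± h` gives `2 s |A g h| ≤ s² A g g + A h h`, and
  -- `s` and `η = s e / 2` make each term on the right at most `s e / 2`.
  set s := e / (2 * (A g g + 1)) with hs
  have hgg := hA0 g
  have hspos : 0 < s := by positivity
  have hsA : s * A g g ≤ e / 2 := by
    rw [hs, div_mul_eq_mul_div, div_le_div_iff₀ (by positivity) two_pos]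
    nlinarith
  refine ⟨s * (e / 2), by positivity, fun h hh hAh => ?_⟩
  have h1 : |inner ℝ (f - S g) h| < e / 2 := by
    refine (abs_real_inner_le_norm _ _).trans_lt ?_
    have hR : ‖h‖ < |R| + 1 := by linarith [le_abs_self R]
    calc ‖f - S g‖ * ‖h‖ ≤ ‖f - S g‖ * (|R| + 1) := by gcongr
      _ < e / (2 * (|R| + 1)) * (|R| + 1) := by
        have : 0 < |R| + 1 := by positivity
        exact mul_lt_mul_of_pos_right hg this
      _ = e / 2 := by
        have : |R| + 1 ≠ 0 := by positivity
        field_simp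
  have h2 : |A g h| ≤ e / 2 := by
    have p1 := hA0 (s • g + h)
    have p2 := hA0 (s • g - h)
    simp only [map_sub, map_add, sub_apply, add_apply,
      map_smul, smul_apply, smul_eq_mul, hsymm h g] at p1 p2
    rw [abs_le]
    constructor
    · refine le_of_mul_le_mul_left ?_ hspos
      nlinarith
    · refine le_of_mul_le_mul_left ?_ hspos
      nlinarith
  have h3 : F h = inner ℝ (f - S g) h + A g h := by
    rw [hF, inner_sub_left, hSin]; ring
  rw [h3]
  exact (abs_add_le _ _).trans_lt (by linarith)

/-- A coercive quadratic functional has exactly one global minimizer. -/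
theorem existsUnique_isGlobalMinimizer [CompleteSpace H]
    (Q : H →L[ℝ] H →L[ℝ] ℝ) (hsymm : ∀ v w, Q v w = Q w v) (hQ : IsCoercive Q)
    (ℓ : StrongDual ℝ H) (a : ℝ) (f : H → ℝ) (hf : ∀ v, f v = Q v v - 2 * ℓ v + a) :
    ∃! ν, IsGlobalMinimizer f ν := by
  set w := (hQ.continuousLinearEquivOfBilin).symm ((InnerProductSpace.toDual ℝ H).symm ℓ) with hw
  have hQw : ∀ v, Q w v = ℓ v := fun v => by
    rw [← hQ.continuousLinearEquivOfBilin_apply, hw, ContinuousLinearEquiv.apply_symm_apply,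
      InnerProductSpace.toDual_symm_apply]
  have hsq : ∀ v, f v = f w + Q (v - w) (v - w) := fun v => by
    rw [hf, hf]
    simp only [map_sub, sub_apply, ← hQw, hsymm v w]
    ring
  obtain ⟨C, hC, hCQ⟩ := hQ
  refine ⟨w, fun v => ?_, fun v hv => ?_⟩
  · rw [hsq v]
    have := hCQ (v - w)
    have : 0 ≤ C * ‖v - w‖ * ‖v - w‖ := by positivity
    linarith
  · have h1 := hv w
    rw [hsq v] at h1
    have h2 := hCQ (v - w)
    have h3 : ‖v - w‖ * ‖v - w‖ ≤ 0 := by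
      by_contra! h
      have := mul_pos hC h
      linarith
    have h4 : ‖v - w‖ = 0 := by nlinarith [norm_nonneg (v - w)]
    exact sub_eq_zero.1 (norm_eq_zero.1 h4)

/-- In an orthogonal decomposition with a finite dimensional summand, the projection onto the
other summand is a contraction. -/
theorem exists_continuousLinearMap_projection {H₀ H₁ : Submodule ℝ H} [FiniteDimensional ℝ H₀]
    (hcompl : IsCompl H₀ H₁) (horth : H₀ ⟂ H₁) :
    ∃ χ : H →L[ℝ] H, (∀ v, H₁.projection H₀ hcompl.symm v = χ v) ∧ (∀ v, v - χ v ∈ H₀) ∧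
      ∀ v, ‖χ v‖ ≤ ‖v‖ := by
  have hbd : ∀ v, ‖H₁.projection H₀ hcompl.symm v‖ ≤ ‖v‖ := fun v => by
    have h1 := Submodule.projection_add_projection_eq_self hcompl v
    have h2 : inner ℝ (H₀.projection H₁ hcompl v) (H₁.projection H₀ hcompl.symm v) = 0 :=
      horth.inner_eq (Submodule.projection_apply_mem _ _) (Submodule.projection_apply_mem _ _)
    have h3 := norm_add_sq_eq_norm_sq_add_norm_sq_real h2
    rw [h1] at h3
    nlinarith [norm_nonneg v, norm_nonneg (H₀.projection H₁ hcompl v),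
      norm_nonneg (H₁.projection H₀ hcompl.symm v)]
  refine ⟨(H₁.projection H₀ hcompl.symm).mkContinuous 1 (by simpa using hbd), fun v => rfl,
    fun v => ?_, hbd⟩
  have h1 := Submodule.projection_add_projection_eq_self hcompl v
  have : v - H₁.projection H₀ hcompl.symm v = H₀.projection H₁ hcompl v := by
    rw [sub_eq_iff_eq_add, h1]
  change v - H₁.projection H₀ hcompl.symm v ∈ H₀
  rw [this]
  exact Submodule.projection_apply_mem _ _

/-! ### The empirical form and the averaged noise -/

/-- The weighted mean `(1/n) ∑_{i < n} x i • ℓ i` of functionals. -/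
noncomputable def weightedMean (ℓ : ℕ → StrongDual ℝ H) (x : ℕ → ℝ) (n : ℕ) : StrongDual ℝ H :=
  (n : ℝ)⁻¹ • ∑ i ∈ Finset.range n, x i • ℓ i

theorem weightedMean_apply (ℓ : ℕ → StrongDual ℝ H) (x : ℕ → ℝ) (n : ℕ) (v : H) :
    weightedMean ℓ x n v = (n : ℝ)⁻¹ * ∑ i ∈ Finset.range n, x i * ℓ i v := by
  simp [weightedMean]

variable [CompleteSpace H]

/-- The rank one operator `v ↦ ℓ v • r`, where `r` represents `ℓ`. -/
noncomputable def rankOneOperator (ℓ : StrongDual ℝ H) : H →L[ℝ] H :=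
  ContinuousLinearMap.smulRight ℓ ((InnerProductSpace.toDual ℝ H).symm ℓ)

theorem inner_rankOneOperator (ℓ : StrongDual ℝ H) (v w : H) :
    inner ℝ (rankOneOperator ℓ v) w = ℓ v * ℓ w := by
  simp [rankOneOperator, inner_smul_left]

theorem norm_rankOneOperator (ℓ : StrongDual ℝ H) : ‖rankOneOperator ℓ‖ = ‖ℓ‖ * ‖ℓ‖ := by
  simp [rankOneOperator]

theorem continuous_rankOneOperator : Continuous (rankOneOperator : StrongDual ℝ H → H →L[ℝ] H) := by
  have : (rankOneOperator : StrongDual ℝ H → H →L[ℝ] H) =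
      fun ℓ => ContinuousLinearMap.smulRightL ℝ H H ℓ ((InnerProductSpace.toDual ℝ H).symm ℓ) :=
    rfl
  rw [this]
  fun_prop

/-- The operator `(1/n) ∑_{i < n} ℓ i ⊗ ℓ i`. -/
noncomputable def empiricalOperator (ℓ : ℕ → StrongDual ℝ H) (n : ℕ) : H →L[ℝ] H :=
  (n : ℝ)⁻¹ • ∑ i ∈ Finset.range n, rankOneOperator (ℓ i)

/-- The form `(v, w) ↦ (1/n) ∑_{i < n} ℓ i v * ℓ i w`. -/
noncomputable def empiricalForm (ℓ : ℕ → StrongDual ℝ H) (n : ℕ) : H →L[ℝ] H →L[ℝ] ℝ :=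
  (innerSL ℝ).comp (empiricalOperator ℓ n)

theorem empiricalForm_apply (ℓ : ℕ → StrongDual ℝ H) (n : ℕ) (v w : H) :
    empiricalForm ℓ n v w = (n : ℝ)⁻¹ * ∑ i ∈ Finset.range n, ℓ i v * ℓ i w := by
  simp [empiricalForm, empiricalOperator, inner_rankOneOperator]

theorem empiricalForm_self_nonneg (ℓ : ℕ → StrongDual ℝ H) (n : ℕ) (v : H) :
    0 ≤ empiricalForm ℓ n v v := by
  rw [empiricalForm_apply]
  exact mul_nonneg (by positivity) (Finset.sum_nonneg fun i _ => mul_self_nonneg _)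

variable {H₀ H₁ : Submodule ℝ H} (hcompl : IsCompl H₀ H₁) {T : Type*} (L : T → StrongDual ℝ H)

theorem splineFunctional_eq (n : ℕ) (lam : ℝ) (t : ℕ → T) (y : ℕ → ℝ) (ν : H) :
    splineFunctional hcompl L n lam t y ν =
      empiricalForm (fun i => L (t i)) n ν ν + lam * ‖H₁.projection H₀ hcompl.symm ν‖ ^ 2
        - 2 * weightedMean (fun i => L (t i)) y n ν
        + (n : ℝ)⁻¹ * ∑ i ∈ Finset.range n, y i ^ 2 := by
  have h : ∑ i ∈ Finset.range n, (y i - L (t i) ν) ^ 2 =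
      ∑ i ∈ Finset.range n, y i ^ 2 - 2 * ∑ i ∈ Finset.range n, y i * L (t i) ν
        + ∑ i ∈ Finset.range n, L (t i) ν * L (t i) ν := by
    rw [Finset.mul_sum, ← Finset.sum_sub_distrib, ← Finset.sum_add_distrib]
    exact Finset.sum_congr rfl fun i _ => by ring
  rw [splineFunctional, h, empiricalForm_apply, weightedMean_apply, one_div]
  ring

/-- Since `lam ≤ 1`, the quadratic part dominates `lam` times the form in `hcoer`, so it is coercive
with constant `lam * c`. -/
theorem existsUnique_isGlobalMinimizer_splineFunctional {χ : H →L[ℝ] H}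
    (hχ : ∀ v, H₁.projection H₀ hcompl.symm v = χ v) (n : ℕ) {lam : ℝ} (hlam : 0 < lam)
    (hlam1 : lam ≤ 1) (t : ℕ → T) (y : ℕ → ℝ) {c : ℝ} (hc : 0 < c)
    (hcoer : ∀ v, c * ‖v‖ ^ 2 ≤ empiricalForm (fun i => L (t i)) n v v + ‖χ v‖ ^ 2) :
    ∃! ν, IsGlobalMinimizer (splineFunctional hcompl L n lam t y) ν := by
  set G : H →L[ℝ] H →L[ℝ] ℝ := (innerSL ℝ).bilinearComp χ χ with hG
  have hGa : ∀ v w, G v w = inner ℝ (χ v) (χ w) := fun v w => by simp [hG]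
  refine existsUnique_isGlobalMinimizer (empiricalForm (fun i => L (t i)) n + lam • G)
    (fun v w => ?_) ⟨lam * c, by positivity, fun v => ?_⟩
    (weightedMean (fun i => L (t i)) y n) ((n : ℝ)⁻¹ * ∑ i ∈ Finset.range n, y i ^ 2) _
    fun v => ?_
  · simp only [add_apply, smul_apply, hGa,
      empiricalForm_apply, real_inner_comm (χ v) (χ w), mul_comm]
  · simp only [add_apply, smul_apply, hGa,
      real_inner_self_eq_norm_sq, smul_eq_mul]
    have h1 := mul_le_mul_of_nonneg_left (hcoer v) hlam.le
    have h2 := mul_le_mul_of_nonneg_right hlam1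
      (empiricalForm_self_nonneg (fun i => L (t i)) n v)
    nlinarith
  · rw [splineFunctional_eq]
    simp only [add_apply, smul_apply, hGa,
      real_inner_self_eq_norm_sq, smul_eq_mul, hχ]

/-- Comparing a minimizer with the true parameter. -/
theorem IsGlobalMinimizer.energy_le {χ : H →L[ℝ] H}
    (hχ : ∀ v, H₁.projection H₀ hcompl.symm v = χ v) (hχ1 : ∀ v, ‖χ v‖ ≤ ‖v‖) {n : ℕ} {lam : ℝ}
    (hlam : 0 ≤ lam) {t : ℕ → T} {μd : H} {x : ℕ → ℝ} {ν : H}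
    (hν : IsGlobalMinimizer (splineFunctional hcompl L n lam t
      fun i => splineDatum L μd (t i) (x i)) ν) :
    empiricalForm (fun i => L (t i)) n (ν - μd) (ν - μd) + lam * ‖χ (ν - μd)‖ ^ 2 ≤
      2 * (‖weightedMean (fun i => L (t i)) x n‖ + lam * ‖μd‖) * ‖ν - μd‖ := by
  have h := hν μd
  set E := empiricalForm (fun i => L (t i)) n with hE
  have hsymm : ∀ v w, E v w = E w v := fun v w => by
    simp only [hE, empiricalForm_apply, mul_comm]
  have hy : ∀ v, weightedMean (fun i => L (t i)) (fun i => splineDatum L μd (t i) (x i)) n v =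
      E μd v + weightedMean (fun i => L (t i)) x n v := fun v => by
    rw [hE, empiricalForm_apply, weightedMean_apply, weightedMean_apply, ← mul_add,
      ← Finset.sum_add_distrib]
    simp only [splineDatum, add_mul]
  rw [splineFunctional_eq, splineFunctional_eq, hy, hy, hχ, hχ] at h
  -- Expanding around `μd`, the terms `E μd k` cancel, leaving `E k k + lam ‖χ k‖² ≤ 2 ξ k - 2 lam
  -- ⟪χ μd, χ k⟫` with `ξ` the averaged noise.
  set k := ν - μd with hk
  have hνk : ν = μd + k := by rw [hk]; abel
  rw [hνk] at h
  simp only [map_add, add_apply, hsymm k μd, ← hE,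
    norm_add_sq_real] at h
  have h1 : weightedMean (fun i => L (t i)) x n k ≤
      ‖weightedMean (fun i => L (t i)) x n‖ * ‖k‖ :=
    (le_abs_self _).trans ((weightedMean (fun i => L (t i)) x n).le_opNorm k)
  have h2 : -(‖μd‖ * ‖k‖) ≤ inner ℝ (χ μd) (χ k) := by
    have := neg_le_of_abs_le (abs_real_inner_le_norm (χ μd) (χ k))
    have := mul_le_mul (hχ1 μd) (hχ1 k) (norm_nonneg _) (norm_nonneg _)
    linarith
  have h3 := mul_le_mul_of_nonneg_left h2 hlam
  nlinarith

end Deterministic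

/-! ### Laws of large numbers -/

section Probabilistic

theorem integrable_of_continuous_of_ae_norm_le {T E : Type*} [TopologicalSpace T]
    [SecondCountableTopology T] [MeasurableSpace T] [BorelSpace T] [NormedAddCommGroup E]
    {φT : Measure T} {g : T → E} {C : ℝ} [IsFiniteMeasure φT] (hg : Continuous g)
    (hbdd : ∀ᵐ s ∂φT, ‖g s‖ ≤ C) : Integrable g φT :=
  Integrable.of_bound hg.stronglyMeasurable.aestronglyMeasurable C hbdd

theorem ae_norm_rankOneOperator_le {H : Type*} [NormedAddCommGroup H] [InnerProductSpace ℝ H]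
    [CompleteSpace H] {T : Type*} [MeasurableSpace T] {L : T → StrongDual ℝ H} {φT : Measure T}
    {α : ℝ} (hbdd : ∀ᵐ s ∂φT, ‖L s‖ ≤ α) :
    ∀ᵐ s ∂φT, ‖rankOneOperator (L s)‖ ≤ α * α := by
  filter_upwards [hbdd] with s hs
  rw [norm_rankOneOperator]
  exact mul_self_le_mul_self (norm_nonneg _) hs

variable {H : Type*} [NormedAddCommGroup H] [InnerProductSpace ℝ H] [CompleteSpace H]
  {T : Type*} [TopologicalSpace T] [SecondCountableTopology T] [MeasurableSpace T] [BorelSpace T]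
  {L : T → StrongDual ℝ H} {φT : Measure T}
  {Ω : Type*} [MeasurableSpace Ω] {P : Measure Ω}
  {t : ℕ → Ω → T} {ε : ℕ → Ω → ℝ}

section BoundedContinuous

variable {E : Type*} [NormedAddCommGroup E] [NormedSpace ℝ E] [CompleteSpace E]
  {g : T → E} {C : ℝ}

/-- The Banach-valued strong law, meant for `g s = L_s ⊗ L_s` in operator norm. `E` need not be
separable: continuity on a second countable space already gives strong measurability. -/
theorem ae_tendsto_mean_of_continuous [IsProbabilityMeasure φT] (hg : Continuous g)
    (hbdd : ∀ᵐ s ∂φT, ‖g s‖ ≤ C) (ht_meas : ∀ i, Measurable (t i))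
    (ht_law : ∀ i, P.map (t i) = φT) (ht_indep : iIndepFun t P) :
    ∀ᵐ ω ∂P, Tendsto (fun n : ℕ => ‖(n : ℝ)⁻¹ • ∑ i ∈ Finset.range n, g (t i ω) - ∫ s, g s ∂φT‖)
      atTop (𝓝 0) := by
  borelize E
  have hint : Integrable (fun ω => g (t 0 ω)) P := by
    have := integrable_of_continuous_of_ae_norm_le hg hbdd
    rw [← ht_law 0] at this
    exact this.comp_measurable (ht_meas 0)
  have h := strong_law_ae (μ := P) (fun i ω => g (t i ω)) hint
    (fun i j hij => (ht_indep.indepFun hij).comp hg.measurable hg.measurable)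
    (fun i => IdentDistrib.comp (⟨(ht_meas i).aemeasurable, (ht_meas 0).aemeasurable,
      (ht_law i).trans (ht_law 0).symm⟩ : IdentDistrib (t i) (t 0) P P) hg.measurable)
  have heq : P[fun ω => g (t 0 ω)] = ∫ s, g s ∂φT := by
    rw [← ht_law 0, integral_map (ht_meas 0).aemeasurable
      hg.stronglyMeasurable.aestronglyMeasurable]
  rw [heq] at h
  filter_upwards [h] with ω hω
  exact tendsto_iff_norm_sub_tendsto_zero.1 hω

theorem tendsto_measure_le_norm_mean_sub [IsProbabilityMeasure P]
    [IsProbabilityMeasure φT] (hg : Continuous g)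
    (hbdd : ∀ᵐ s ∂φT, ‖g s‖ ≤ C) (ht_meas : ∀ i, Measurable (t i))
    (ht_law : ∀ i, P.map (t i) = φT) (ht_indep : iIndepFun t P) {κ : ℝ} (hκ : 0 < κ) :
    Tendsto (fun n : ℕ => P {ω | κ ≤ ‖(n : ℝ)⁻¹ • ∑ i ∈ Finset.range n, g (t i ω) -
      ∫ s, g s ∂φT‖}) atTop (𝓝 0) := by
  have h := tendstoInMeasure_of_tendsto_ae (fun n => ?_)
    (ae_tendsto_mean_of_continuous hg hbdd ht_meas ht_law ht_indep)
  · simpa using tendstoInMeasure_iff_norm.1 h κ hκ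
  · have hs : StronglyMeasurable fun ω => ∑ i ∈ Finset.range n, g (t i ω) :=
      Finset.stronglyMeasurable_fun_sum _ fun i _ =>
        hg.stronglyMeasurable.comp_measurable (ht_meas i)
    exact ((hs.const_smul _).sub stronglyMeasurable_const).norm.aestronglyMeasurable

end BoundedContinuous

theorem inner_integral_rankOneOperator [IsFiniteMeasure φT] (hcont : Continuous L) {α : ℝ}
    (hbdd : ∀ᵐ s ∂φT, ‖L s‖ ≤ α) (v w : H) :
    inner ℝ ((∫ s, rankOneOperator (L s) ∂φT) v) w = ∫ s, L s v * L s w ∂φT := by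
  have hi : Integrable (fun s => rankOneOperator (L s)) φT :=
    integrable_of_continuous_of_ae_norm_le (continuous_rankOneOperator.comp hcont)
      (ae_norm_rankOneOperator_le hbdd)
  rw [ContinuousLinearMap.integral_apply hi, real_inner_comm,
    ← integral_inner (hi.apply_continuousLinearMap v)]
  refine integral_congr_ae (ae_of_all _ fun s => ?_)
  beta_reduce
  rw [real_inner_comm, inner_rankOneOperator]

theorem norm_sq_weightedMean (ℓ : ℕ → StrongDual ℝ H) (x : ℕ → ℝ) (n : ℕ) :
    ‖weightedMean ℓ x n‖ ^ 2 = ((n : ℝ)⁻¹) ^ 2 * ∑ i ∈ Finset.range n, ∑ j ∈ Finset.range n,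
      (x i * x j) * inner ℝ ((InnerProductSpace.toDual ℝ H).symm (ℓ i))
        ((InnerProductSpace.toDual ℝ H).symm (ℓ j)) := by
  rw [← (InnerProductSpace.toDual ℝ H).symm.norm_map, ← real_inner_self_eq_norm_sq, weightedMean]
  simp only [map_smulₛₗ, map_sum, inner_smul_left, inner_smul_right, sum_inner, inner_sum]
  simp only [conj_trivial, Finset.mul_sum]
  refine Finset.sum_congr rfl fun i _ => Finset.sum_congr rfl fun j _ => ?_
  rw [real_inner_comm]
  ring

/-- In the expanded square the off-diagonal terms integrate to zero, the noise being centered,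
independent across indices and independent of the design. Only `n` bounded diagonal terms remain,
against the factor `n⁻²`. -/
theorem integral_norm_sq_weightedMean_le [IsProbabilityMeasure P]
    [IsProbabilityMeasure φT] (hcont : Continuous L) {α : ℝ}
    (hbdd : ∀ᵐ s ∂φT, ‖L s‖ ≤ α) (ht_meas : ∀ i, Measurable (t i))
    (ht_law : ∀ i, P.map (t i) = φT) {φ0 : Measure ℝ} (hsq : MemLp id 2 φ0)
    (hmean : ∫ x, x ∂φ0 = 0) (hε_meas : ∀ i, Measurable (ε i)) (hε_law : ∀ i, P.map (ε i) = φ0)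
    (hε_indep : iIndepFun ε P)
    (htε_indep : IndepFun (fun ω i => t i ω) (fun ω i => ε i ω) P) {n : ℕ} (hn : 0 < n) :
    Integrable (fun ω => ‖weightedMean (fun i => L (t i ω)) (fun i => ε i ω) n‖ ^ 2) P ∧
    ∫ ω, ‖weightedMean (fun i => L (t i ω)) (fun i => ε i ω) n‖ ^ 2 ∂P ≤
      (n : ℝ)⁻¹ * ((∫ x, x ^ 2 ∂φ0) * α ^ 2) := by
  set R := (InnerProductSpace.toDual ℝ H).symm with hR
  set G : ℕ → ℕ → Ω → ℝ := fun i j ω => inner ℝ (R (L (t i ω))) (R (L (t j ω))) with hG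
  have hgc : Continuous fun q : T × T => inner ℝ (R (L q.1)) (R (L q.2)) := by fun_prop
  have hGm : ∀ i j, Measurable (G i j) := fun i j =>
    hgc.measurable.comp ((ht_meas i).prodMk (ht_meas j))
  have hbt : ∀ i, ∀ᵐ ω ∂P, ‖L (t i ω)‖ ≤ α := fun i => by
    have := hbdd
    rw [← ht_law i] at this
    exact ae_of_ae_map (ht_meas i).aemeasurable this
  have hGb : ∀ i j, ∀ᵐ ω ∂P, ‖G i j ω‖ ≤ α ^ 2 := fun i j => by
    filter_upwards [hbt i, hbt j] with ω hi hj
    refine (abs_real_inner_le_norm _ _).trans ?_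
    rw [hR, LinearIsometryEquiv.norm_map, LinearIsometryEquiv.norm_map, sq]
    exact mul_le_mul hi hj (norm_nonneg _) ((norm_nonneg _).trans hi)
  have hGi : ∀ i j, Integrable (G i j) P := fun i j =>
    Integrable.of_bound (hGm i j).aestronglyMeasurable _ (hGb i j)
  have hεL : ∀ i, MemLp (ε i) 2 P := fun i => by
    have := hsq
    rw [← hε_law i] at this
    exact (memLp_map_measure_iff aestronglyMeasurable_id (hε_meas i).aemeasurable).1 this
  have hεi : ∀ i, ∫ ω, ε i ω ∂P = 0 := fun i => by
    rw [← hmean, ← hε_law i, integral_map (hε_meas i).aemeasurable (by fun_prop)]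
  have hεs : ∀ i, ∫ ω, ε i ω * ε i ω ∂P = ∫ x, x ^ 2 ∂φ0 := fun i => by
    rw [← hε_law i, integral_map (hε_meas i).aemeasurable (by fun_prop)]
    simp only [sq]
  have hεε : ∀ i j, Integrable (fun ω => ε i ω * ε j ω) P := fun i j =>
    (hεL i).integrable_mul (hεL j)
  have hind : ∀ i j, IndepFun (fun ω => ε i ω * ε j ω) (G i j) P := fun i j => by
    have h1 : Measurable fun u : ℕ → ℝ => u i * u j := by fun_prop
    have h2 : Measurable fun u : ℕ → T => inner ℝ (R (L (u i))) (R (L (u j))) := by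
      have h3 : Measurable fun u : ℕ → T => (u i, u j) := by fun_prop
      exact hgc.measurable.comp h3
    exact htε_indep.symm.comp h1 h2
  have hXi : ∀ i j, Integrable (fun ω => (ε i ω * ε j ω) * G i j ω) P := fun i j =>
    (hind i j).integrable_mul (hεε i j) (hGi i j)
  have hXint : ∀ i j, ∫ ω, (ε i ω * ε j ω) * G i j ω ∂P =
      (∫ ω, ε i ω * ε j ω ∂P) * ∫ ω, G i j ω ∂P := fun i j =>
    (hind i j).integral_fun_mul_eq_mul_integral (hεε i j).aestronglyMeasurable
      (hGi i j).aestronglyMeasurable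
  have hoff : ∀ i j, i ≠ j → ∫ ω, (ε i ω * ε j ω) * G i j ω ∂P = 0 := fun i j hij => by
    rw [hXint, (hε_indep.indepFun hij).integral_fun_mul_eq_mul_integral
      (hε_meas i).aestronglyMeasurable (hε_meas j).aestronglyMeasurable, hεi i]
    simp
  have hdiag : ∀ i, ∫ ω, (ε i ω * ε i ω) * G i i ω ∂P ≤ (∫ x, x ^ 2 ∂φ0) * α ^ 2 := fun i => by
    rw [hXint, hεs]
    refine mul_le_mul_of_nonneg_left ?_ (integral_nonneg fun x => sq_nonneg x)
    calc ∫ ω, G i i ω ∂P ≤ ∫ _, α ^ 2 ∂P := by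
          refine integral_mono_ae (hGi i i) (integrable_const _) ?_
          filter_upwards [hGb i i] with ω hω
          exact (le_abs_self _).trans hω
      _ = α ^ 2 := by simp
  have hnorm : (fun ω => ‖weightedMean (fun i => L (t i ω)) (fun i => ε i ω) n‖ ^ 2) =
      fun ω => ((n : ℝ)⁻¹) ^ 2 * ∑ i ∈ Finset.range n, ∑ j ∈ Finset.range n,
        (ε i ω * ε j ω) * G i j ω := by
    funext ω
    rw [norm_sq_weightedMean]
  have hsumi : ∀ i, Integrable (fun ω => ∑ j ∈ Finset.range n, (ε i ω * ε j ω) * G i j ω) P :=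
    fun i => integrable_finsetSum _ fun j _ => hXi i j
  rw [hnorm]
  refine ⟨(integrable_finsetSum _ fun i _ => hsumi i).const_mul _, ?_⟩
  rw [integral_const_mul, integral_finsetSum _ fun i _ => hsumi i]
  have hrow : ∀ i ∈ Finset.range n, ∫ ω, ∑ j ∈ Finset.range n, (ε i ω * ε j ω) * G i j ω ∂P ≤
      (∫ x, x ^ 2 ∂φ0) * α ^ 2 := fun i hi => by
    rw [integral_finsetSum _ fun j _ => hXi i j,
      Finset.sum_eq_single i (fun j _ hji => hoff i j hji.symm) (fun h => absurd hi h)]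
    exact hdiag i
  have hsum := Finset.sum_le_card_nsmul _ _ _ hrow
  rw [Finset.card_range, nsmul_eq_mul] at hsum
  have hn' : (n : ℝ) ≠ 0 := by positivity
  calc _ ≤ ((n : ℝ)⁻¹) ^ 2 * (n * ((∫ x, x ^ 2 ∂φ0) * α ^ 2)) := by gcongr
    _ = _ := by field_simp

/-- The averaged noise has size `O(n ^ (-1/2))` in probability. -/
theorem exists_measure_weightedMean_le [IsProbabilityMeasure P]
    [IsProbabilityMeasure φT] (hcont : Continuous L) {α : ℝ}
    (hbdd : ∀ᵐ s ∂φT, ‖L s‖ ≤ α) (ht_meas : ∀ i, Measurable (t i))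
    (ht_law : ∀ i, P.map (t i) = φT) {φ0 : Measure ℝ} (hsq : MemLp id 2 φ0)
    (hmean : ∫ x, x ∂φ0 = 0) (hε_meas : ∀ i, Measurable (ε i)) (hε_law : ∀ i, P.map (ε i) = φ0)
    (hε_indep : iIndepFun ε P)
    (htε_indep : IndepFun (fun ω i => t i ω) (fun ω i => ε i ω) P) {δ : ℝ} (hδ : 0 < δ) :
    ∃ K : ℝ, 0 < K ∧ ∀ n : ℕ, 0 < n →
      P {ω | K * (n : ℝ) ^ (-(1 / 2) : ℝ) ≤
        ‖weightedMean (fun i => L (t i ω)) (fun i => ε i ω) n‖} ≤ ENNReal.ofReal δ := by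
  set V := (∫ x, x ^ 2 ∂φ0) * α ^ 2 with hV
  have hV0 : 0 ≤ V := mul_nonneg (integral_nonneg fun x => sq_nonneg x) (sq_nonneg _)
  -- Markov's inequality for the squared norm, of mean at most `V / n`; the `+ 1` keeps `K` positive
  -- when `V = 0`.
  refine ⟨√((V + 1) / δ), by positivity, fun n hn => ?_⟩
  obtain ⟨hi, hle⟩ := integral_norm_sq_weightedMean_le hcont hbdd ht_meas ht_law hsq hmean hε_meas
    hε_law hε_indep htε_indep hn
  have hn' : (0 : ℝ) < n := by exact_mod_cast hn
  have hpow : ((n : ℝ) ^ (-(1 / 2) : ℝ)) ^ 2 = (n : ℝ)⁻¹ := by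
    rw [← Real.rpow_natCast, ← Real.rpow_mul hn'.le, ← Real.rpow_neg_one]
    norm_num
  have hM := mul_meas_ge_le_integral_of_nonneg (f := fun ω =>
    ‖weightedMean (fun i => L (t i ω)) (fun i => ε i ω) n‖ ^ 2)
    (ae_of_all _ fun ω => sq_nonneg _) hi ((V + 1) / δ * (n : ℝ)⁻¹)
  have hsub : {ω | √((V + 1) / δ) * (n : ℝ) ^ (-(1 / 2) : ℝ) ≤
      ‖weightedMean (fun i => L (t i ω)) (fun i => ε i ω) n‖} ⊆
      {ω | (V + 1) / δ * (n : ℝ)⁻¹ ≤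
        ‖weightedMean (fun i => L (t i ω)) (fun i => ε i ω) n‖ ^ 2} := fun ω hω => by
    have h0 : 0 ≤ √((V + 1) / δ) * (n : ℝ) ^ (-(1 / 2) : ℝ) := by positivity
    have h := pow_le_pow_left₀ h0 (Set.mem_ofPred_eq ▸ hω) 2
    rwa [mul_pow, hpow, Real.sq_sqrt (by positivity)] at h
  refine (measure_mono hsub).trans ?_
  rw [← ofReal_measureReal]
  refine ENNReal.ofReal_le_ofReal ?_
  have h1 := hM.trans hle
  have h2 : 0 < (V + 1) / δ * (n : ℝ)⁻¹ := by positivity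
  refine le_of_mul_le_mul_left (h1.trans ?_) h2
  have : (V + 1) / δ * (n : ℝ)⁻¹ * δ = (n : ℝ)⁻¹ * (V + 1) := by field_simp
  rw [this]
  gcongr
  linarith

end Probabilistic

/-! ### Weak consistency of the smoothing spline -/

theorem mainTheorem1
    -- the space `H = H₀ ⊕ H₁` (orthogonal sum), `dim H₀ = m < ∞`, `dim H₁ = ∞`
    {H : Type*} [NormedAddCommGroup H] [InnerProductSpace ℝ H] [CompleteSpace H]
    [TopologicalSpace.SeparableSpace H]
    (H₀ H₁ : Submodule ℝ H) (hcompl : IsCompl H₀ H₁) (horth : H₀ ⟂ H₁)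
    (m : ℕ) (hfin : FiniteDimensional ℝ H₀) (hm : Module.finrank ℝ H₀ = m)
    (hinf : ¬ FiniteDimensional ℝ H₁)
    -- the family of observation operators `L_t`, `t ∈ I ⊆ ℝᵈ`, and the design law `φT`
    {d : ℕ} (I : Set (EuclideanSpace ℝ (Fin d))) (L : I → StrongDual ℝ H)
    (φT : Measure I) [IsProbabilityMeasure φT]
    -- the noise law `φ0`: centered, with variance `σ²`
    (φ0 : Measure ℝ) [IsProbabilityMeasure φ0] (σ : ℝ)
    (hφ0_sq : MemLp id 2 φ0) (hφ0_mean : (∫ x, x ∂φ0) = 0) (hφ0_var : Var[id; φ0] = σ ^ 2)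
    -- the probability space and the two independent iid sequences `t i ∼ φT` and `ε i ∼ φ0`
    {Ω : Type*} [MeasurableSpace Ω] (P : Measure Ω) [IsProbabilityMeasure P]
    (t : ℕ → Ω → I) (ε : ℕ → Ω → ℝ)
    (ht_meas : ∀ i, Measurable (t i)) (ht_law : ∀ i, P.map (t i) = φT)
    (ht_indep : iIndepFun t P)
    (hε_meas : ∀ i, Measurable (ε i)) (hε_law : ∀ i, P.map (ε i) = φ0)
    (hε_indep : iIndepFun ε P)
    (htε_indep : IndepFun (fun ω i => t i ω) (fun ω i => ε i ω) P)
    -- the support of `φT` has at least `m` points, and the `L_t` are distinct on `H₀`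
    (hsupp : (m : ℕ∞) ≤ φT.support.encard)
    (huniq : ∀ s r : I, (∀ ν ∈ H₀, L s ν = L r ν) → s = r)
    -- essential boundedness of `t ↦ ‖L_t‖`
    (hbdd : ∃ α : ℝ, 0 < α ∧ ∀ᵐ s ∂φT, ‖L s‖ ≤ α)
    -- the regularization is `λ_n = n ^ (-p)`
    (p : ℝ) (hp_pos : 0 < p) (hp_le : p ≤ 1 / 2)
    -- identifiability
    (hnorm : ∀ ν : H, (∫ s, (L s ν) ^ 2 ∂φT) = 0 ↔ ν = 0)
    -- continuity of `t ↦ L_t` in the dual norm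
    (hcont : Continuous L)
    -- the parameter to be recovered
    (μd : H) :
    -- almost surely, for all large `n`, the functional `f_n` has a unique minimizer
    (∀ᵐ ω ∂P, ∀ᶠ n : ℕ in atTop, ∃! ν : H,
      IsGlobalMinimizer (splineFunctional hcompl L n ((n : ℝ) ^ (-p)) (fun i => t i ω)
        (fun i => splineDatum L μd (t i ω) (ε i ω))) ν) ∧
    -- and the minimizers `μ^n` (with any values where there is no unique minimizer) converge
    (∀ μn : ℕ → Ω → H,
      (∀ᵐ ω ∂P, ∀ n : ℕ,
        (∃! ν : H, IsGlobalMinimizer (splineFunctional hcompl L n ((n : ℝ) ^ (-p))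
          (fun i => t i ω) (fun i => splineDatum L μd (t i ω) (ε i ω))) ν) →
        IsGlobalMinimizer (splineFunctional hcompl L n ((n : ℝ) ^ (-p))
          (fun i => t i ω) (fun i => splineDatum L μd (t i ω) (ε i ω))) (μn n ω)) →
      ∀ F : StrongDual ℝ H, ∀ e δ : ℝ, 0 < e → 0 < δ →
        ∃ N : ℕ, ∀ n ≥ N, P {ω | e ≤ |F (μn n ω) - F μd|} ≤ ENNReal.ofReal δ) := by
  obtain ⟨α, -, hα⟩ := hbdd
  obtain ⟨χ, hχ, hχ0, hχ1⟩ := exists_continuousLinearMap_projection hcompl horth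
  set S : H →L[ℝ] H := ∫ s, rankOneOperator (L s) ∂φT with hS
  set A : H →L[ℝ] H →L[ℝ] ℝ := (innerSL ℝ).comp S with hAdef
  have hAapp : ∀ v w, A v w = ∫ s, L s v * L s w ∂φT :=
    inner_integral_rankOneOperator hcont hα
  have hA0 : ∀ v, 0 ≤ A v v := fun v => by
    rw [hAapp]
    exact integral_nonneg fun s => mul_self_nonneg _
  have hApos : ∀ v, A v v = 0 → v = 0 := fun v hv => by
    rw [hAapp] at hv
    exact (hnorm v).1 (by simpa only [sq] using hv)
  have hAsymm : ∀ v w, A v w = A w v := fun v w => by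
    simp only [hAapp, mul_comm]
  obtain ⟨c, hc, hcoer⟩ := exists_coercive_add_norm_sq A hA0 hApos χ hχ0
  have hdiff : ∀ (ℓ : ℕ → StrongDual ℝ H) (n : ℕ) (v : H),
      |A v v - empiricalForm ℓ n v v| ≤ ‖empiricalOperator ℓ n - S‖ * ‖v‖ ^ 2 := fun ℓ n v => by
    have h1 : A v v - empiricalForm ℓ n v v = -inner ℝ ((empiricalOperator ℓ n - S) v) v := by
      rw [sub_apply, inner_sub_left, neg_sub]
      rfl
    rw [h1, abs_neg, sq, ← mul_assoc]
    refine (abs_real_inner_le_norm _ _).trans ?_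
    gcongr
    exact (empiricalOperator ℓ n - S).le_opNorm v
  have hcoer' : ∀ (ℓ : ℕ → StrongDual ℝ H) (n : ℕ), ‖empiricalOperator ℓ n - S‖ < c / 2 →
      ∀ v, c / 2 * ‖v‖ ^ 2 ≤ empiricalForm ℓ n v v + ‖χ v‖ ^ 2 := fun ℓ n hB v => by
    have h1 := hcoer v
    have h2 := (le_abs_self _).trans (hdiff ℓ n v)
    have h3 := mul_le_mul_of_nonneg_right hB.le (sq_nonneg ‖v‖)
    linarith
  have hlam : ∀ n : ℕ, 0 < n → 0 < (n : ℝ) ^ (-p) ∧ (n : ℝ) ^ (-p) ≤ 1 := fun n hn =>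
    ⟨Real.rpow_pos_of_pos (by exact_mod_cast hn) _,
      Real.rpow_le_one_of_one_le_of_nonpos (by exact_mod_cast hn) (by linarith)⟩
  have huni : ∀ (n : ℕ) (ω : Ω), 0 < n → ‖empiricalOperator (fun i => L (t i ω)) n - S‖ < c / 2 →
      ∃! ν : H, IsGlobalMinimizer (splineFunctional hcompl L n ((n : ℝ) ^ (-p))
        (fun i => t i ω) (fun i => splineDatum L μd (t i ω) (ε i ω))) ν := fun n ω hn hω =>
    existsUnique_isGlobalMinimizer_splineFunctional hcompl L hχ n (hlam n hn).1 (hlam n hn).2 _ _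
      (half_pos hc) (hcoer' _ _ hω)
  refine ⟨?_, fun μn hμn F e δ he hδ => ?_⟩
  · filter_upwards [ae_tendsto_mean_of_continuous
      (continuous_rankOneOperator.comp hcont) (ae_norm_rankOneOperator_le hα) ht_meas ht_law
      ht_indep] with ω hω
    filter_upwards [eventually_gt_atTop 0,
      hω.eventually_lt_const (half_pos hc)] with n hn hn'
    exact huni n ω hn hn'
  obtain ⟨K, hK, hKn⟩ := exists_measure_weightedMean_le hcont hα ht_meas ht_law hφ0_sq hφ0_mean
    hε_meas hε_law hε_indep htε_indep (half_pos hδ)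
  -- Radius obtained by cancelling `λ‖k‖` in `λ (c/2) ‖k‖² ≤ 2 (K + ‖μd‖) λ ‖k‖`.
  set R := 2 * (K + ‖μd‖) / (c / 2) with hR
  have hR0 : 0 ≤ R := by positivity
  obtain ⟨η, hη, hηF⟩ := exists_forall_abs_lt_of_apply_self_le A hAsymm hA0 hApos F R he
  -- The first bound keeps the empirical form coercive; the second keeps it within `η / 2` of `A` on
  -- the ball of radius `R`.
  set κ := min (c / 2) (η / (2 * (R ^ 2 + 1))) with hκdef
  have hκ : 0 < κ := lt_min (half_pos hc) (by positivity)
  have hlim : Tendsto (fun n : ℕ => 2 * ((K + ‖μd‖) * (n : ℝ) ^ (-p)) * R) atTop (𝓝 0) := by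
    have h1 : Tendsto (fun n : ℕ => (n : ℝ) ^ (-p)) atTop (𝓝 0) :=
      (tendsto_rpow_neg_atTop hp_pos).comp tendsto_natCast_atTop_atTop
    simpa using ((h1.const_mul (K + ‖μd‖)).const_mul 2).mul_const R
  have hev1 := hlim.eventually_lt_const (half_pos hη)
  have hev2 := (tendsto_measure_le_norm_mean_sub (continuous_rankOneOperator.comp hcont)
    (ae_norm_rankOneOperator_le hα) ht_meas ht_law ht_indep hκ).eventually_lt_const (ENNReal.ofReal_pos.2 (half_pos hδ))
  obtain ⟨N, hN⟩ := eventually_atTop.1 ((eventually_gt_atTop 0).and (hev1.and hev2))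
  refine ⟨N, fun n hn => ?_⟩
  obtain ⟨hn0, hn1, hn2⟩ := hN n hn
  -- Almost surely, failure forces a large operator deviation or large noise, each of probability at
  -- most `δ / 2`. Monotonicity of the outer measure makes measurability of `μn` unnecessary.
  have hgood : ∀ᵐ ω ∂P, ω ∈ {ω | e ≤ |F (μn n ω) - F μd|} →
      ω ∈ {ω | κ ≤ ‖empiricalOperator (fun i => L (t i ω)) n - S‖} ∪
        {ω | K * (n : ℝ) ^ (-(1 / 2) : ℝ) ≤
          ‖weightedMean (fun i => L (t i ω)) (fun i => ε i ω) n‖} := by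
    filter_upwards [hμn] with ω hω hbad
    by_contra hcon
    simp only [Set.mem_union, Set.mem_ofPred_eq, not_or, not_le] at hcon hbad
    obtain ⟨hB, hξ⟩ := hcon
    have hB' := hB.trans_le (min_le_left _ _)
    have hmin := hω n (huni n ω hn0 hB')
    have hen := hmin.energy_le hcompl L hχ hχ1 (hlam n hn0).1.le
    have hco := hcoer' _ _ hB' (μn n ω - μd)
    have hE := empiricalForm_self_nonneg (fun i => L (t i ω)) n (μn n ω - μd)
    obtain ⟨hl0, hl1⟩ := hlam n hn0
    -- Here `p ≤ 1/2` enters: the penalty decays no faster than the noise.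
    have hll : (n : ℝ) ^ (-(1 / 2) : ℝ) ≤ (n : ℝ) ^ (-p) :=
      Real.rpow_le_rpow_of_exponent_le (by exact_mod_cast hn0) (by linarith)
    have hab := (abs_le.1 (hdiff (fun i => L (t i ω)) n (μn n ω - μd))).2
    set l := (n : ℝ) ^ (-p) with hl
    set ξ := ‖weightedMean (fun i => L (t i ω)) (fun i => ε i ω) n‖ with hξdef
    set k := μn n ω - μd with hk
    set B := empiricalForm (fun i => L (t i ω)) n with hBdef
    have hξl : ξ + l * ‖μd‖ ≤ (K + ‖μd‖) * l := by
      have := mul_le_mul_of_nonneg_left hll hK.le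
      linarith
    have hen' : B k k + l * ‖χ k‖ ^ 2 ≤ 2 * ((K + ‖μd‖) * l) * ‖k‖ :=
      hen.trans (by gcongr)
    have hkR : ‖k‖ ≤ R := by
      rcases (norm_nonneg k).eq_or_lt with h0 | h0
      · rw [← h0]; exact hR0
      rw [hR, le_div_iff₀ (half_pos hc)]
      have h1 : l * (c / 2 * ‖k‖ ^ 2) ≤ B k k + l * ‖χ k‖ ^ 2 := by
        have h2 := mul_le_mul_of_nonneg_left hco hl0.le
        have h3 := mul_le_mul_of_nonneg_right hl1 hE
        linarith
      have h4 := h1.trans hen'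
      refine le_of_mul_le_mul_left ?_ (mul_pos hl0 h0)
      linarith
    have hAk : A k k ≤ η := by
      have h1 : B k k ≤ 2 * ((K + ‖μd‖) * l) * R := by
        have : 0 ≤ l * ‖χ k‖ ^ 2 := by positivity
        have h2 : 2 * ((K + ‖μd‖) * l) * ‖k‖ ≤ 2 * ((K + ‖μd‖) * l) * R := by gcongr
        linarith
      have h3 : ‖empiricalOperator (fun i => L (t i ω)) n - S‖ * ‖k‖ ^ 2 ≤ η / 2 := by
        calc ‖empiricalOperator (fun i => L (t i ω)) n - S‖ * ‖k‖ ^ 2 ≤ η / (2 * (R ^ 2 + 1)) * (R ^ 2 + 1) := by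
              have h4 := hB.le.trans (min_le_right _ _)
              have h5 : ‖k‖ ^ 2 ≤ R ^ 2 + 1 := by
                have := pow_le_pow_left₀ (norm_nonneg k) hkR 2
                linarith
              gcongr
          _ = η / 2 := by field_simp
      linarith
    have := hηF k hkR hAk
    rw [hk, map_sub] at this
    exact absurd hbad (not_le.2 this)
  calc P {ω | e ≤ |F (μn n ω) - F μd|} ≤ _ := measure_mono_ae hgood
    _ ≤ _ := measure_union_le _ _
    _ ≤ ENNReal.ofReal (δ / 2) + ENNReal.ofReal (δ / 2) := add_le_add hn2.le (hKn n hn0)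
    _ = ENNReal.ofReal δ := by
      rw [← ENNReal.ofReal_add (by positivity) (by positivity), add_halves]
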